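/- For $c\in\mathbb C$ let $f_c(z)=z^2+c$. For a sequence $\omega=(c_0,c_1,c_2,\dots)$ of complex numbers put $f^n_\omega=f_{c_{n-1}}\circ\cdots\circ f_{c_0}$, and let $J_\omega$ be the set of all $z\in\mathbb C$ such that for every open set $U\ni z$ the family $\{f^n_\omega|_U\}_{n\in\mathbb N}$ is not normal (where a family of holomorphic functions on $U$ is normal if every sequence of its members has a subsequence that converges locally uniformly on $U$ with respect to the spherical metric, the limit $\infty$ being allowed). Let $R>1/4$, let $\mathbb D(0,R)=\{c\in\mathbb C:|c|<R\}$, let $\lambda_R$ be the normalized Lebesgue measure on $\mathbb D(0,R)$, and equip $\Omega=\mathbb D(0,R)^{\mathbb N}$ with the product measure $\mathbb P=\bigotimes_{n=0}^\infty\lambda_R$. Then the set $$\mathcal T=\{\omega\in\Omega: J_\omega\text{ is totally disconnected}\}$$ has full measure: $\mathcal T$ is measurable with respect to the completion of $\mathbb P$, and $\mathbb P(\mathcal T)=1$. -/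

import Mathlib

open MeasureTheory Filter Topology

noncomputable section

namespace RandomJulia

/-- The non-autonomous iterates `f^n_ω = f_{c_{n-1}} ∘ ⋯ ∘ f_{c_0}` of the quadratic maps
`f_c z = z ^ 2 + c` along the parameter sequence `ω = (c_0, c_1, …)`; `f^0_ω` is the identity. -/
def iter (ω : ℕ → ℂ) : ℕ → ℂ → ℂ
  | 0, z => z
  | n + 1, z => iter ω n z ^ 2 + ω n

/-- The family `F i`, `i : ι`, is normal on `U`: every sequence of members of the family has a
subsequence that converges, locally uniformly on `U`, to a map into the Riemann sphere
`OnePoint ℂ`. The sphere carries its unique compatible uniform structure, which is the one induced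
by the spherical (chordal) metric; the constant limit `∞` is allowed. -/
def IsNormalFamilyOn {ι : Type*} (F : ι → ℂ → ℂ) (U : Set ℂ) : Prop :=
  letI : UniformSpace (OnePoint ℂ) := uniformSpaceOfCompactR1
  ∀ s : ℕ → ι, ∃ φ : ℕ → ℕ, StrictMono φ ∧ ∃ g : ℂ → OnePoint ℂ,
    TendstoLocallyUniformlyOn (fun j z => (F (s (φ j)) z : OnePoint ℂ)) g atTop U

/-- The non-autonomous Julia set of `ω`: the points that have no open neighbourhood on which the
family of iterates is normal. -/
def juliaSet (ω : ℕ → ℂ) : Set ℂ :=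
  {z | ∀ U : Set ℂ, IsOpen U → z ∈ U → ¬ IsNormalFamilyOn (iter ω) U}

/-- The open disk of radius `R` about `0`. -/
abbrev Disk (R : ℝ) : Set ℂ := Metric.ball 0 R

/-- Lebesgue measure on the disk, divided by its total mass. -/
def diskMeasure (R : ℝ) : Measure (Disk R) :=
  ((volume : Measure ℂ) (Disk R))⁻¹ • Measure.comap Subtype.val (volume : Measure ℂ)

/-- The product measure on the space of parameter sequences. -/
def sequenceMeasure (R : ℝ) : Measure (ℕ → Disk R) :=
  Measure.infinitePi fun _ : ℕ => diskMeasure R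

theorem isProbabilityMeasure_diskMeasure {R : ℝ} (hR : 0 < R) :
    IsProbabilityMeasure (diskMeasure R) := by
  constructor
  have h0 : (volume : Measure ℂ) (Disk R) ≠ 0 := (Metric.measure_ball_pos volume 0 hR).ne'
  have h1 : (volume : Measure ℂ) (Disk R) ≠ ⊤ := measure_ball_lt_top.ne
  have h2 : Measure.comap (Subtype.val : Disk R → ℂ) volume Set.univ
      = (volume : Measure ℂ) (Disk R) := by
    rw [(MeasurableEmbedding.subtype_coe Metric.isOpen_ball.measurableSet).comap_apply,
      Set.image_univ, Subtype.range_coe]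
  simp only [diskMeasure, Measure.smul_apply, smul_eq_mul, h2]
  exact ENNReal.inv_mul_cancel h0 h1

end RandomJulia

end

namespace RandomJulia

open Metric Set Bornology ProbabilityTheory
open scoped ENNReal

/-! The proof splits into a probabilistic and a deterministic half, joined by the escape of critical
points.

Since `|z|² + 1/4 ≥ |z|` and `R > 1/4`, a random parameter increases `|z|` by a fixed amount with
probability bounded below, uniformly in `z`. Hence a critical point `0` started at any time is still
below level `2(R + 2)` after `k` steps with probability at most `2q^k`, `q < 1`
(`exists_measure_norm_iter_lt_le`). Summing over starting times `n < k`, some critical point of the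
first `k` steps has not escaped at time `k + L` with probability at most `C q^L`, uniformly in `k`.
So almost surely there is an `L` for which infinitely many `k` are good: all these critical points
have escaped by time `k + L`.

At a good time `k`, the map `f^k_ω` has a holomorphic inverse on each component of `{|f^{k+L}_ω| < R
+ 3}` (`exists_inverse_branch`). Only the last `L` steps then matter for the hyperbolic geometry,
and they are uniformly controlled: the component at a later good time has bounded hyperbolic
diameter in the present one. By Schwarz–Pick, holomorphic maps to the disk vanishing at `x` contract
by a fixed factor (`exists_contraction`). Over infinitely many nested components this leaves a
single point (`isTotallyDisconnected_of_frequently`), and the Julia set consists of non-escaping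
points (`juliaSet_subset`). -/

/-! ### Iterates and the escape radius `R + 2`. -/

theorem iter_add (ω : ℕ → ℂ) (n k : ℕ) (z : ℂ) :
    iter ω (n + k) z = iter (fun i => ω (n + i)) k (iter ω n z) := by
  induction k with
  | zero => rfl
  | succ k ih => rw [← add_assoc, iter, iter, ih]

theorem iter_succ' (ω : ℕ → ℂ) (n : ℕ) (z : ℂ) :
    iter ω (n + 1) z = iter (fun i => ω (i + 1)) n (z ^ 2 + ω 0) := by
  rw [add_comm, iter_add]
  simp only [iter, add_comm]

theorem differentiable_iter (ω : ℕ → ℂ) (n : ℕ) : Differentiable ℂ (iter ω n) := by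
  induction n with
  | zero => exact differentiable_id
  | succ n ih => exact (ih.pow 2).add_const _

theorem two_mul_norm_le {R : ℝ} (hR : 0 ≤ R) {c z : ℂ} (hc : ‖c‖ ≤ R) (hz : R + 2 ≤ ‖z‖) :
    2 * ‖z‖ ≤ ‖z ^ 2 + c‖ := by
  have h := norm_sub_le (z ^ 2 + c) c
  rw [add_sub_cancel_right, norm_pow] at h
  nlinarith

theorem two_pow_mul_norm_le {R : ℝ} (hR : 0 ≤ R) {ω : ℕ → ℂ} (hω : ∀ n, ‖ω n‖ ≤ R) {z : ℂ}
    (hz : R + 2 ≤ ‖z‖) (n : ℕ) : 2 ^ n * ‖z‖ ≤ ‖iter ω n z‖ := by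
  induction n with
  | zero => simp [iter]
  | succ n ih =>
    have h1 : (1 : ℝ) ≤ 2 ^ n := one_le_pow₀ (by norm_num)
    have h2 : R + 2 ≤ ‖iter ω n z‖ := by nlinarith
    have := two_mul_norm_le hR (hω n) h2
    rw [iter, pow_succ]
    linarith

theorem norm_le_norm_iter {R : ℝ} (hR : 0 ≤ R) {ω : ℕ → ℂ} (hω : ∀ n, ‖ω n‖ ≤ R) {z : ℂ}
    (hz : R + 2 ≤ ‖z‖) (n : ℕ) : ‖z‖ ≤ ‖iter ω n z‖ := by
  have h1 : (1 : ℝ) ≤ 2 ^ n := one_le_pow₀ (by norm_num)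
  have := two_pow_mul_norm_le hR hω hz n
  nlinarith [norm_nonneg z]

/-- If an iterate is smaller than a radius beyond the escape radius, so is the point itself. -/
theorem norm_lt_of_norm_iter_lt {R ρ : ℝ} (hR : 0 ≤ R) (hρ : R + 2 ≤ ρ) {ω : ℕ → ℂ}
    (hω : ∀ n, ‖ω n‖ ≤ R) {z : ℂ} {n : ℕ} (hz : ‖iter ω n z‖ < ρ) : ‖z‖ < ρ := by
  by_contra! h
  exact absurd (norm_le_norm_iter hR hω (hρ.trans h) n) (by linarith)

/-- Equicontinuity of the `L`-th iterates, uniformly in the parameter sequence. -/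
theorem exists_norm_iter_sub_lt {R : ℝ} (hR : 0 ≤ R) (L : ℕ) {η : ℝ} (hη : 0 < η) :
    ∃ δ > 0, ∀ ω : ℕ → ℂ, (∀ n, ‖ω n‖ ≤ R) → ∀ w w' : ℂ, ‖iter ω L w‖ < R + 2 →
      ‖w' - w‖ < δ → ‖iter ω L w' - iter ω L w‖ < η := by
  induction L generalizing η with
  | zero => exact ⟨η, hη, fun ω _ w w' _ h => h⟩
  | succ L ih =>
    have hD : 0 < 2 * (R + 2) + 1 := by linarith
    obtain ⟨δ, hδ, H⟩ := ih (lt_min one_pos (div_pos hη hD))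
    refine ⟨δ, hδ, fun ω hω w w' hw hww' => ?_⟩
    have h1 : ‖iter ω L w‖ < R + 2 := by
      by_contra! h
      have := two_mul_norm_le hR (hω L) h
      rw [iter] at hw
      linarith
    have h2 := H ω hω w w' h1 hww'
    set u := iter ω L w
    set v := iter ω L w'
    obtain ⟨h3, h4⟩ := lt_min_iff.1 h2
    have h5 : iter ω (L + 1) w' - iter ω (L + 1) w = (v - u) * ((v - u) + 2 * u) := by
      simp only [iter]; ring
    have h6 : ‖(v - u) + 2 * u‖ ≤ 2 * (R + 2) + 1 := by
      refine (norm_add_le _ _).trans ?_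
      rw [norm_mul, Complex.norm_ofNat]
      linarith
    rw [h5, norm_mul]
    rw [lt_div_iff₀ hD] at h4
    exact (mul_le_mul_of_nonneg_left h6 (norm_nonneg _)).trans_lt h4

/-! ### Holomorphic square roots and inverse branches. -/

/-- `1 + u` has a square root depending holomorphically on `u` in the unit disk. -/
theorem exists_sqrt_of_norm_sub_one_lt {f : ℂ → ℂ} {s : Set ℂ} (hf : DifferentiableOn ℂ f s)
    (h : ∀ z ∈ s, ‖f z - 1‖ < 1) : ∃ g : ℂ → ℂ, DifferentiableOn ℂ g s ∧ ∀ z ∈ s, g z ^ 2 = f z := by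
  have hsl : ∀ z ∈ s, f z ∈ Complex.slitPlane := fun z hz => by
    simpa using Complex.mem_slitPlane_of_norm_lt_one (h z hz)
  refine ⟨fun z => f z ^ (1 / 2 : ℂ), ?_, fun z _ => ?_⟩
  · exact fun z hz => (hf z hz).cpow_const (hsl z hz)
  · simp [← Complex.cpow_nat_mul]

/-- On a bounded sublevel set of an entire function `P`, the function `z - c` has a holomorphic
square root whenever `P c` is larger than the level. -/
theorem exists_sqrt_sub_of_sublevel {P : ℂ → ℂ} (hP : Differentiable ℂ P) {a b : ℝ} (hab : a < b)
    (hbd : IsBounded {z | ‖P z‖ < a}) {c : ℂ} (hc : b ≤ ‖P c‖) :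
    ∃ s : ℂ → ℂ, DifferentiableOn ℂ s {z | ‖P z‖ < a} ∧
      ∀ z ∈ {z | ‖P z‖ < a}, s z ^ 2 = z - c := by
  set S := {z | ‖P z‖ < a} with hS
  obtain ⟨M, hM⟩ : ∃ M, ∀ z ∈ S, ‖z‖ ≤ M := hbd.exists_norm_le
  have hPc : Continuous P := hP.continuous
  have hcl : closure S ⊆ {z | ‖P z‖ ≤ a} :=
    closure_minimal (fun z (hz : ‖P z‖ < a) => hz.le) (isClosed_le hPc.norm continuous_const)
  obtain ⟨δ, hδ, hsep⟩ := hbd.isCompact_closure.exists_thickening_subset_open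
    (isOpen_lt hPc.norm (continuous_const (y := b))) (fun z hz => (hcl hz).trans_lt hab)
  have hfar : ∀ p, b ≤ ‖P p‖ → ∀ z ∈ S, δ ≤ dist p z := by
    intro p hp z hz
    by_contra! h
    exact absurd (hsep (mem_thickening_iff.2 ⟨z, subset_closure hz, h⟩)) (not_lt.2 hp)
  let Q : ℂ → Prop := fun c => ∃ s : ℂ → ℂ, DifferentiableOn ℂ s S ∧ ∀ z ∈ S, s z ^ 2 = z - c
  -- The bad points form a bounded set, stable under moves shorter than `δ` inside `{b ≤ ‖P‖}`. The
  -- maximum principle forbids such a set: it would confine a bounded piece of `{b ≤ ‖P‖}`.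
  set N := {p | b ≤ ‖P p‖ ∧ ¬ Q p} with hN
  by_contra hcon
  have hcN : c ∈ N := ⟨hc, hcon⟩
  have hNbd : IsBounded N := by
    refine (isBounded_closedBall (x := (0 : ℂ)) (r := |M| + 1)).subset fun p hp => ?_
    by_contra hpM
    rw [mem_closedBall_zero_iff, not_le] at hpM
    have hp0 : p ≠ 0 := by
      rintro rfl
      rw [norm_zero] at hpM
      linarith [abs_nonneg M]
    refine hp.2 ?_
    obtain ⟨g, hg, hg2⟩ := exists_sqrt_of_norm_sub_one_lt (f := fun z => 1 - z / p) (s := S)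
      (by fun_prop) (fun z hz => by
        have h1 := hM z hz
        rw [sub_sub_cancel_left, norm_neg, norm_div, div_lt_one (norm_pos_iff.2 hp0)]
        linarith [le_abs_self M])
    refine ⟨fun z => (-p) ^ (1 / 2 : ℂ) * g z, hg.const_mul _, fun z hz => ?_⟩
    have h2 : ((-p) ^ (1 / 2 : ℂ)) ^ 2 = -p := by
      simp [← Complex.cpow_nat_mul]
    rw [mul_pow, h2, hg2 z hz]
    field_simp
    ring
  have hstep : ∀ p ∈ N, ∀ q, b ≤ ‖P q‖ → dist p q < δ → q ∈ N := by
    refine fun p hp q hq hpq => ⟨hq, fun ⟨s, hs, hs2⟩ => hp.2 ?_⟩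
    have hne : ∀ z ∈ S, z - q ≠ 0 := fun z hz h0 => by
      have := hfar q hq z hz
      rw [sub_eq_zero.1 h0, dist_self] at this
      linarith
    -- The ratio differs from `1` by `(q - p)/(z - q)`, of norm below `1`, so a root of `z - q`
    -- yields one of `z - p`.
    obtain ⟨g, hg, hg2⟩ := exists_sqrt_of_norm_sub_one_lt (f := fun z => (z - p) / (z - q)) (s := S)
      (by fun_prop (disch := assumption)) (fun z hz => by
        have h1 := hfar q hq z hz
        have h2 : (z - p) / (z - q) - 1 = (q - p) / (z - q) := by
          field_simp [hne z hz]
          ring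
        rw [h2, norm_div, div_lt_one (norm_pos_iff.2 (hne z hz)), ← dist_eq_norm, ← dist_eq_norm,
          dist_comm q p, dist_comm z q]
        exact hpq.trans_le h1)
    refine ⟨fun z => s z * g z, hs.mul hg, fun z hz => ?_⟩
    rw [mul_pow, hs2 z hz, hg2 z hz, mul_div_cancel₀ _ (hne z hz)]
  have hU : IsBounded (thickening (δ / 2) N) := hNbd.thickening
  -- The maximum lies at distance exactly `δ / 2` from `N`, yet has `‖P p‖ ≥ ‖P c‖ ≥ b`, so `hstep`
  -- puts it in `N`.
  obtain ⟨p, hpf, hpmax⟩ := Complex.exists_mem_frontier_isMaxOn_norm hU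
    ⟨c, self_subset_thickening (half_pos hδ) N hcN⟩ hP.diffContOnCl
  have h1 : ‖P c‖ ≤ ‖P p‖ := hpmax (subset_closure (self_subset_thickening (half_pos hδ) N hcN))
  have h2 : infEDist p N = ENNReal.ofReal (δ / 2) := frontier_thickening_subset N hpf
  have h3 : infEDist p N < ENNReal.ofReal δ := by
    rw [h2]; exact (ENNReal.ofReal_lt_ofReal_iff hδ).2 (by linarith)
  obtain ⟨q, hq, hpq⟩ := mem_thickening_iff.1 (mem_thickening_iff_infEDist_lt.2 h3)
  have h4 := hstep q hq p (hc.trans h1) (by rwa [dist_comm])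
  rw [infEDist_zero_of_mem h4] at h2
  have := ENNReal.ofReal_pos.2 (half_pos hδ)
  rw [← h2] at this
  exact lt_irrefl _ this

/-- If the critical values of the first `k` steps have escaped at time `k + L`, then `iter ω k` has a
holomorphic right inverse on a sublevel set of the remaining `L` steps, and it inverts `iter ω k` on
a given preconnected set. -/
theorem exists_inverse_branch {R ρ : ℝ} (hR : 0 ≤ R) (hρ : R + 2 ≤ ρ) {ρ' : ℝ} (hρ' : ρ < ρ')
    (L k : ℕ) {ω : ℕ → ℂ} (hω : ∀ n, ‖ω n‖ ≤ R)
    (hcrit : ∀ n < k, ρ' ≤ ‖iter (fun i => ω (n + i)) (k + L - n) 0‖)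
    {C : Set ℂ} (hC : IsPreconnected C) (hCs : ∀ z ∈ C, ‖iter ω (k + L) z‖ < ρ) :
    ∃ g : ℂ → ℂ, DifferentiableOn ℂ g {w | ‖iter (fun i => ω (k + i)) L w‖ < ρ} ∧
      (∀ w ∈ {w | ‖iter (fun i => ω (k + i)) L w‖ < ρ}, iter ω k (g w) = w) ∧
      ∀ z ∈ C, g (iter ω k z) = z := by
  induction k generalizing ω C with
  | zero => exact ⟨id, differentiableOn_id, fun w _ => rfl, fun z _ => rfl⟩
  | succ k ih =>
    set ω₁ : ℕ → ℂ := fun i => ω (i + 1) with hω₁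
    have hsucc : ∀ n z, iter ω (n + 1) z = iter ω₁ n (z ^ 2 + ω 0) := iter_succ' ω
    have hsh : ∀ n, (fun i => ω (n + 1 + i)) = fun i => ω₁ (n + i) := fun n => by
      funext i; simp only [hω₁]; congr 1; ring
    have hkL : k + 1 + L = k + L + 1 := by ring
    have hcont : Continuous fun z : ℂ => z ^ 2 + ω 0 := by fun_prop
    obtain ⟨g, hg, hg1, hg2⟩ := ih (ω := ω₁) (fun n => hω _) (fun n hn => by
      have := hcrit (n + 1) (by omega)
      rwa [hsh, show k + 1 + L - (n + 1) = k + L - n by omega] at this)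
      (hC.image _ hcont.continuousOn) (by
        rintro _ ⟨z, hz, rfl⟩
        rw [← hsucc, ← hkL]
        exact hCs z hz)
    have hbd : IsBounded {z | ‖iter ω₁ (k + L) z‖ < ρ} :=
      (isBounded_ball (x := (0 : ℂ)) (r := ρ)).subset fun z hz => mem_ball_zero_iff.2
        (norm_lt_of_norm_iter_lt hR hρ (fun n => hω _) hz)
    have hc0 := hcrit 0 (by omega)
    simp only [zero_add, Nat.sub_zero] at hc0
    -- Inverting the first step requires a root of `z - ω 0`; its critical value `ω 0` lies above
    -- the level by `hcrit 0`.
    obtain ⟨s, hs, hs2⟩ := exists_sqrt_sub_of_sublevel (differentiable_iter ω₁ (k + L)) hρ' hbd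
      (c := ω 0) (by simpa [hkL, hsucc] using hc0)
    rw [hsh k]
    have hmaps : MapsTo g {w | ‖iter (fun i => ω₁ (k + i)) L w‖ < ρ}
        {z | ‖iter ω₁ (k + L) z‖ < ρ} := fun w hw => by
      rw [mem_ofPred_eq, iter_add, hg1 w hw]
      exact hw
    have hmapsC : MapsTo (fun z : ℂ => z ^ 2 + ω 0) C {z | ‖iter ω₁ (k + L) z‖ < ρ} := fun z hz => by
      rw [mem_ofPred_eq, ← hsucc, ← hkL]
      exact hCs z hz
    have hne : ∀ {z}, z ∈ C → z ≠ 0 := by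
      rintro z hz rfl
      have := hCs 0 hz
      linarith
    -- Connectedness of `C`, which avoids the critical point, selects one global sign of the root.
    have hsign := hC.eq_or_eq_neg_of_sq_eq (f := fun z => s (z ^ 2 + ω 0)) (g := fun z => z)
      (hs.continuousOn.comp hcont.continuousOn hmapsC) continuousOn_id
      (fun z hz => by
        have := hs2 _ (hmapsC hz)
        simpa using this) hne
    have hgk : ∀ z ∈ C, g (iter ω (k + 1) z) = z ^ 2 + ω 0 := fun z hz => by
      rw [hsucc]
      exact hg2 _ ⟨z, hz, rfl⟩
    rcases hsign with h | h
    · refine ⟨fun w => s (g w), hs.comp hg hmaps, fun w hw => ?_, fun z hz => ?_⟩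
      · rw [hsucc, hs2 _ (hmaps hw), sub_add_cancel, hg1 w hw]
      · simpa only [hgk z hz] using h hz
    · refine ⟨fun w => -s (g w), (hs.comp hg hmaps).neg, fun w hw => ?_, fun z hz => ?_⟩
      · rw [hsucc, neg_sq, hs2 _ (hmaps hw), sub_add_cancel, hg1 w hw]
      · have := h hz
        simp only [Pi.neg_apply] at this
        simp only [hgk z hz, this, neg_neg]

/-! ### Schwarz–Pick, Harnack chains and uniform contraction. -/

/-- A Harnack inequality for maps into the unit disk. -/
theorem one_sub_norm_sq_harnack {h : ℂ → ℂ} {w w' : ℂ} {δ : ℝ}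
    (hd : DifferentiableOn ℂ h (ball w δ)) (hb : ∀ z ∈ ball w δ, ‖h z‖ ≤ 1)
    (hw' : dist w' w < δ / 2) : 3 / 16 * (1 - ‖h w‖ ^ 2) ≤ 1 - ‖h w'‖ ^ 2 := by
  have hδ : 0 < δ := by linarith [dist_nonneg.trans_lt hw']
  have hw'm : w' ∈ ball w δ := mem_ball.2 (by linarith)
  have hbw' := hb w' hw'm
  set a := h w with ha
  have hal := hb w (mem_ball_self hδ)
  rcases hal.eq_or_lt with h1 | h1
  · rw [h1]; nlinarith [norm_nonneg (h w')]
  have key : ∀ z : ℂ, ‖z‖ ≤ 1 → 1 - ‖a‖ ≤ ‖1 - (starRingEnd ℂ) a * z‖ := fun z hz => by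
    have := norm_sub_norm_le (1 : ℂ) ((starRingEnd ℂ) a * z)
    rw [norm_one, norm_mul, RCLike.norm_conj] at this
    nlinarith [norm_nonneg a, norm_nonneg z]
  have hne : ∀ z : ℂ, ‖z‖ ≤ 1 → 1 - (starRingEnd ℂ) a * z ≠ 0 := fun z hz h0 => by
    have := key z hz
    rw [h0, norm_zero] at this
    linarith
  have hid : ∀ z : ℂ, ‖1 - (starRingEnd ℂ) a * z‖ ^ 2 - ‖z - a‖ ^ 2
      = (1 - ‖a‖ ^ 2) * (1 - ‖z‖ ^ 2) := fun z => by
    simp only [← Complex.normSq_eq_norm_sq, Complex.normSq_apply, Complex.sub_re, Complex.sub_im,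
      Complex.mul_re, Complex.mul_im, Complex.conj_re, Complex.conj_im, Complex.one_re,
      Complex.one_im]
    ring
  have ha2 : 0 < 1 - ‖a‖ ^ 2 := by nlinarith [norm_nonneg a]
  -- Schwarz lemma for `h` followed by the disk automorphism sending `a` to `0`: at half the radius
  -- the value has norm at most `1/2`. With `hid` this gives the factor `3/4`, and `(1 + ‖a‖)² ≤ 4`
  -- reduces it to `3/16`.
  have hS := Complex.dist_le_div_mul_dist_of_mapsTo_ball
    (f := fun z => (h z - a) / (1 - (starRingEnd ℂ) a * h z)) (c := w) (R₁ := δ) (R₂ := 1) (z := w')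
    ((hd.sub_const a).div ((hd.const_mul _).const_sub 1) fun z hz => hne _ (hb z hz))
    (fun z hz => by
      have hz1 := hb z hz
      rw [← ha, sub_self, zero_div, mem_closedBall_zero_iff, norm_div,
        div_le_one (norm_pos_iff.2 (hne _ hz1))]
      refine le_of_sq_le_sq ?_ (norm_nonneg _)
      have := hid (h z)
      have : 0 ≤ (1 - ‖a‖ ^ 2) * (1 - ‖h z‖ ^ 2) :=
        mul_nonneg ha2.le (by nlinarith [norm_nonneg (h z)])
      linarith) hw'm
  have hpos := norm_pos_iff.2 (hne _ hbw')
  rw [← ha, sub_self, zero_div, dist_zero_right, norm_div, div_le_iff₀ hpos] at hS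
  have h2 : 1 / δ * dist w' w ≤ 1 / 2 := by
    rw [one_div_mul_eq_div, div_le_iff₀ hδ]; linarith
  have h3 : ‖h w' - a‖ ≤ 1 / 2 * ‖1 - (starRingEnd ℂ) a * h w'‖ :=
    hS.trans (mul_le_mul_of_nonneg_right h2 hpos.le)
  have h4 := hid (h w')
  have h5 := key _ hbw'
  set D := ‖1 - (starRingEnd ℂ) a * h w'‖
  have h6 : ‖h w' - a‖ ^ 2 ≤ D ^ 2 / 4 := by
    have := pow_le_pow_left₀ (norm_nonneg _) h3 2
    linarith [this]
  have h7 : (1 - ‖a‖) ^ 2 ≤ D ^ 2 := pow_le_pow_left₀ (by linarith) h5 2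
  have h8 : 3 / 16 * (1 - ‖a‖ ^ 2) ^ 2 ≤ 3 / 4 * (1 - ‖a‖) ^ 2 := by
    have : (1 - ‖a‖ ^ 2) ^ 2 = (1 - ‖a‖) ^ 2 * (1 + ‖a‖) ^ 2 := by ring
    rw [this]
    have : (1 + ‖a‖) ^ 2 ≤ 4 := by nlinarith [norm_nonneg a]
    nlinarith [sq_nonneg (1 - ‖a‖)]
  refine le_of_mul_le_mul_left ?_ ha2
  nlinarith

/-- A Harnack chain: on a preconnected set of bounded size, a positive function that changes by at
most the factor `q` on the scale `ε` is bounded below in terms of its value at one point. -/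
theorem exists_chain_bound {A ε q : ℝ} (hε : 0 < ε) (hq : 0 < q) (hq1 : q ≤ 1) :
    ∃ N : ℕ, ∀ (V : Set ℂ) (u : ℂ → ℝ) (x : ℂ), IsPreconnected V → V ⊆ ball 0 A → x ∈ V →
      u x = 1 → (∀ w ∈ V, ∀ w' ∈ V, dist w' w < ε → q * u w ≤ u w') →
      ∀ y ∈ V, q ^ N ≤ u y := by
  obtain ⟨t, -, hfin, ht⟩ := (isCompact_closedBall (0 : ℂ) A).finite_cover_balls (half_pos hε)
  refine ⟨hfin.toFinset.card + 1, fun V u x hV hVA hx hux hu y hy => ?_⟩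
  have hcov : ∀ v ∈ V, ∃ c ∈ hfin.toFinset, v ∈ ball c (ε / 2) := fun v hv => by
    obtain ⟨c, hc, hvc⟩ := mem_iUnion₂.1 (ht (ball_subset_closedBall (hVA hv)))
    exact ⟨c, hfin.mem_toFinset.2 hc, hvc⟩
  have hball : ∀ c v w, v ∈ V → w ∈ V → v ∈ ball c (ε / 2) → w ∈ ball c (ε / 2) → q * u v ≤ u w :=
    fun c v w hv hw hvc hwc => hu v hv w hw
      ((dist_triangle_right w v c).trans_lt (by rw [mem_ball] at hvc hwc; linarith))
  -- Grow a family of balls one at a time from one containing `x`. By connectedness, until `V` is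
  -- covered some new ball meets an old one inside `V`, at the cost of one factor `q`. The total
  -- number of balls bounds the number of stages.
  have main : ∀ n : ℕ, ∃ T ⊆ hfin.toFinset, (n + 1 ≤ T.card ∨ V ⊆ ⋃ c ∈ T, ball c (ε / 2)) ∧
      (∃ c ∈ T, x ∈ ball c (ε / 2)) ∧
      ∀ c ∈ T, ∀ v ∈ V, v ∈ ball c (ε / 2) → q ^ (n + 1) ≤ u v := by
    intro n
    induction n with
    | zero =>
      obtain ⟨c, hc, hxc⟩ := hcov x hx
      refine ⟨{c}, by simpa using hc, Or.inl (by simp), ⟨c, by simp, hxc⟩, ?_⟩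
      intro c' hc' v hv hvc
      rw [Finset.mem_singleton.1 hc'] at hvc
      simpa [hux] using hball c x v hx hv hxc hvc
    | succ n ih =>
      obtain ⟨T, hT, hcard, hxT, hlow⟩ := ih
      have hlow' : ∀ c ∈ T, ∀ v ∈ V, v ∈ ball c (ε / 2) → q ^ (n + 1 + 1) ≤ u v :=
        fun c hc v hv hvc => (pow_le_pow_of_le_one hq.le hq1 (Nat.le_succ _)).trans
          (hlow c hc v hv hvc)
      by_cases hall : V ⊆ ⋃ c ∈ T, ball c (ε / 2)
      · exact ⟨T, hT, Or.inr hall, hxT, hlow'⟩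
      obtain ⟨p, hpV, hpT⟩ := not_subset.1 hall
      obtain ⟨c₀, hc₀, hpc₀⟩ := hcov p hpV
      have hc₀T : c₀ ∉ T := fun h => hpT (mem_iUnion₂.2 ⟨c₀, h, hpc₀⟩)
      obtain ⟨v, hvV, hv1, hv2⟩ := hV (⋃ c ∈ T, ball c (ε / 2))
        (⋃ c ∈ hfin.toFinset \ T, ball c (ε / 2))
        (isOpen_biUnion fun _ _ => isOpen_ball) (isOpen_biUnion fun _ _ => isOpen_ball)
        (fun v hv => by
          obtain ⟨c, hc, hvc⟩ := hcov v hv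
          by_cases hcT : c ∈ T
          · exact Or.inl (mem_iUnion₂.2 ⟨c, hcT, hvc⟩)
          · exact Or.inr (mem_iUnion₂.2 ⟨c, Finset.mem_sdiff.2 ⟨hc, hcT⟩, hvc⟩))
        (by
          obtain ⟨c, hc, hxc⟩ := hxT
          exact ⟨x, hx, mem_iUnion₂.2 ⟨c, hc, hxc⟩⟩)
        ⟨p, hpV, mem_iUnion₂.2 ⟨c₀, Finset.mem_sdiff.2 ⟨hc₀, hc₀T⟩, hpc₀⟩⟩
      obtain ⟨c₁, hc₁, hvc₁⟩ := mem_iUnion₂.1 hv1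
      obtain ⟨c₂, hc₂, hvc₂⟩ := mem_iUnion₂.1 hv2
      rw [Finset.mem_sdiff] at hc₂
      refine ⟨insert c₂ T, Finset.insert_subset hc₂.1 hT, Or.inl ?_, ?_, ?_⟩
      · rw [Finset.card_insert_of_notMem hc₂.2]
        exact Nat.succ_le_succ (hcard.resolve_right hall)
      · obtain ⟨c, hc, hxc⟩ := hxT
        exact ⟨c, Finset.mem_insert_of_mem hc, hxc⟩
      · intro c hc v' hv' hvc'
        rcases Finset.mem_insert.1 hc with rfl | hc
        · have h1 := hball c v v' hvV hv' hvc₂ hvc'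
          have h2 := hlow c₁ hc₁ v hvV hvc₁
          rw [pow_succ']
          exact (mul_le_mul_of_nonneg_left h2 hq.le).trans h1
        · exact hlow' c hc v' hv' hvc'
  obtain ⟨T, hT, hcard, -, hlow⟩ := main hfin.toFinset.card
  have hVT := hcard.resolve_left (by
    have := Finset.card_le_card hT
    omega)
  obtain ⟨c, hc, hyc⟩ := mem_iUnion₂.1 (hVT hy)
  exact hlow c hc y hy hyc

/-- If all critical points of the first `k` steps escape by time `k + L`, then holomorphic maps from
a component of a sublevel set at time `k + L` into the unit disk contract by a factor that depends
only on `L` and `R`. -/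
theorem exists_contraction {R : ℝ} (hR : 0 ≤ R) (L : ℕ) :
    ∃ r : ℝ, 0 < r ∧ r < 1 ∧ ∀ (ω : ℕ → ℂ) (k : ℕ), (∀ n, ‖ω n‖ ≤ R) →
      (∀ n < k, 2 * (R + 2) ≤ ‖iter (fun i => ω (n + i)) (k + L - n) 0‖) →
      ∀ (x : ℂ) (V : Set ℂ) (h : ℂ → ℂ), IsPreconnected V → x ∈ V →
        (∀ z ∈ V, ‖iter ω (k + L) z‖ < R + 2) →
        DifferentiableOn ℂ h (connectedComponentIn {z | ‖iter ω (k + L) z‖ < R + 3} x) →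
        (∀ z ∈ connectedComponentIn {z | ‖iter ω (k + L) z‖ < R + 3} x, ‖h z‖ ≤ 1) →
        h x = 0 → ∀ y ∈ V, ‖h y‖ ≤ r := by
  -- The gap `1` between levels `R + 2` and `R + 3` becomes a radius `δ` at time `k`, depending only
  -- on `L` and `R`.
  obtain ⟨δ, hδ, hequi⟩ := exists_norm_iter_sub_lt hR L one_pos
  obtain ⟨N, hN⟩ := exists_chain_bound (A := R + 2) (ε := δ / 2) (q := 3 / 16) (half_pos hδ)
    (by norm_num) (by norm_num)
  have hq0 : (0 : ℝ) < (3 / 16) ^ (N + 1) := by positivity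
  have hq1 : ((3 : ℝ) / 16) ^ (N + 1) < 1 := pow_lt_one₀ (by norm_num) (by norm_num) (by omega)
  refine ⟨√(1 - (3 / 16) ^ (N + 1)), Real.sqrt_pos.2 (by linarith), ?_, ?_⟩
  · rw [Real.sqrt_lt' one_pos]; linarith
  intro ω k hω hcrit x V h hV hxV hVs hd hb hx y hy
  set Ω := {z | ‖iter ω (k + L) z‖ < R + 3} with hΩ
  set W := connectedComponentIn Ω x with hW
  have hVΩ : V ⊆ Ω := fun z hz => (hVs z hz).trans (by linarith)
  have hWΩ : W ⊆ Ω := connectedComponentIn_subset Ω x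
  have hVW : V ⊆ W := hV.subset_connectedComponentIn hxV hVΩ
  obtain ⟨g, hg, hg1, hg2⟩ := exists_inverse_branch (ρ := R + 3) hR (by linarith)
    (ρ' := 2 * (R + 2)) (by linarith) L k hω hcrit (C := W) isPreconnected_connectedComponentIn
    (fun z hz => hWΩ hz)
  have hcont := (differentiable_iter ω k).continuous
  have hVlt : ∀ z ∈ V, ‖iter (fun i => ω (k + i)) L (iter ω k z)‖ < R + 2 := fun z hz => by
    rw [← iter_add]; exact hVs z hz
  have hsub : ∀ z ∈ V, ball (iter ω k z) δ ⊆ {w | ‖iter (fun i => ω (k + i)) L w‖ < R + 3} := by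
    intro z hz w hw
    have h1 := hequi _ (fun n => hω (k + n)) _ w (hVlt z hz) (mem_ball_iff_norm.1 hw)
    have h2 := norm_le_insert' (iter (fun i => ω (k + i)) L w)
      (iter (fun i => ω (k + i)) L (iter ω k z))
    have h3 := hVlt z hz
    rw [mem_ofPred_eq]
    linarith
  -- The image of a ball under the branch is connected and contains `z`, so it stays in the
  -- component `W`, where `h` is defined.
  have hmaps : ∀ z ∈ V, MapsTo g (ball (iter ω k z) δ) W := by
    intro z hz
    have hpre : IsPreconnected (g '' ball (iter ω k z) δ) :=
      (convex_ball _ _).isPreconnected.image _ (hg.continuousOn.mono (hsub z hz))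
    have hsubΩ : g '' ball (iter ω k z) δ ⊆ Ω := by
      rintro _ ⟨w, hw, rfl⟩
      have := hsub z hz hw
      rw [hΩ, mem_ofPred_eq, iter_add, hg1 w this]
      exact this
    have hzmem : z ∈ g '' ball (iter ω k z) δ :=
      ⟨_, mem_ball_self hδ, hg2 z (hVW hz)⟩
    have := hpre.subset_connectedComponentIn hzmem hsubΩ
    rw [← connectedComponentIn_eq (hVW hz)] at this
    exact fun w hw => this ⟨w, hw, rfl⟩
  have hchain := hN (iter ω k '' V) (fun w => 1 - ‖h (g w)‖ ^ 2) (iter ω k x)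
    (hV.image _ hcont.continuousOn)
    (by
      rintro _ ⟨z, hz, rfl⟩
      exact mem_ball_zero_iff.2
        (norm_lt_of_norm_iter_lt hR le_rfl (fun n => hω (k + n)) (hVlt z hz)))
    ⟨x, hxV, rfl⟩ (by simp [hg2 x (hVW hxV), hx])
    (by
      rintro _ ⟨z, hz, rfl⟩ w' - hw'
      exact one_sub_norm_sq_harnack (h := fun w => h (g w))
        (hd.comp (hg.mono (hsub z hz)) (hmaps z hz)) (fun w hw => hb _ (hmaps z hz hw)) hw')
    _ ⟨y, hy, rfl⟩
  simp only [hg2 y (hVW hy)] at hchain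
  have hle : ((3 : ℝ) / 16) ^ (N + 1) ≤ (3 / 16) ^ N :=
    pow_le_pow_of_le_one (by norm_num) (by norm_num) (Nat.le_succ N)
  exact Real.le_sqrt_of_sq_le (by linarith)

/-! ### Total disconnectedness from nested contractions. -/

/-- If for infinitely many `k` all critical points of the first `k` steps escape by time `k + L`,
then the set of points that never leave the escape disk is totally disconnected. -/
theorem isTotallyDisconnected_of_frequently {R : ℝ} (hR : 0 ≤ R) {ω : ℕ → ℂ} (hω : ∀ n, ‖ω n‖ ≤ R)
    (L : ℕ) (hfreq : ∃ᶠ k in atTop,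
      ∀ n < k, 2 * (R + 2) ≤ ‖iter (fun i => ω (n + i)) (k + L - n) 0‖) :
    IsTotallyDisconnected {z | ∀ n, ‖iter ω n z‖ < R + 2} := by
  obtain ⟨r, hr0, hr1, hr⟩ := exists_contraction hR L
  intro C hCK hC x hx y hy
  -- Quantifying over all `h` makes the induction work: after one contraction, `h / r` is again a
  -- disk-valued map on the next component.
  have key : ∀ (j k : ℕ), (∀ n < k, 2 * (R + 2) ≤ ‖iter (fun i => ω (n + i)) (k + L - n) 0‖) →
      ∀ h : ℂ → ℂ, DifferentiableOn ℂ h (connectedComponentIn {z | ‖iter ω (k + L) z‖ < R + 3} x) →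
        (∀ z ∈ connectedComponentIn {z | ‖iter ω (k + L) z‖ < R + 3} x, ‖h z‖ ≤ 1) →
        h x = 0 → ‖h y‖ ≤ r ^ j := by
    intro j
    induction j with
    | zero =>
      intro k _ h _ hb _
      rw [pow_zero]
      exact hb y (hC.subset_connectedComponentIn hx
        (fun z hz => (hCK hz (k + L)).trans (by linarith)) hy)
    | succ j ih =>
      intro k hk h hd hb h0
      obtain ⟨k', hkk', hk'⟩ := frequently_atTop.1 hfreq (k + 1)
      set V := connectedComponentIn {z | ‖iter ω (k' + L) z‖ < R + 3} x with hV
      -- A point at or above `R + 2` at time `k + L` would at least double its norm by the later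
      -- time `k' + L`, passing `2(R + 2) ≥ R + 3`.
      have hVs : ∀ z ∈ V, ‖iter ω (k + L) z‖ < R + 2 := by
        intro z hz
        by_contra! hlt
        have h1 : ‖iter ω (k' + L) z‖ < R + 3 :=
          (connectedComponentIn_subset {z | ‖iter ω (k' + L) z‖ < R + 3} x) hz
        obtain ⟨m, rfl⟩ : ∃ m, k' = k + (m + 1) := ⟨k' - k - 1, by omega⟩
        rw [show k + (m + 1) + L = k + L + (m + 1) by ring, iter_add] at h1
        have h2 := two_pow_mul_norm_le hR (fun n => hω (k + L + n)) hlt (m + 1)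
        have h3 : (2 : ℝ) ≤ 2 ^ (m + 1) := by
          rw [pow_succ]
          linarith [one_le_pow₀ (M₀ := ℝ) (a := 2) (n := m) (by norm_num)]
        nlinarith
      have hxV : x ∈ V := mem_connectedComponentIn ((hCK hx (k' + L)).trans (by linarith))
      have hVW : V ⊆ connectedComponentIn {z | ‖iter ω (k + L) z‖ < R + 3} x :=
        isPreconnected_connectedComponentIn.subset_connectedComponentIn hxV
          fun z hz => (hVs z hz).trans (by linarith)
      have h1 := hr ω k hω hk x V h isPreconnected_connectedComponentIn hxV hVs hd hb h0
      have h2 := ih k' hk' (fun z => h z / r) ((hd.mono hVW).div_const _)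
        (fun z hz => by
          rw [norm_div, Complex.norm_real, Real.norm_of_nonneg hr0.le, div_le_one hr0]
          exact h1 z hz) (by simp [h0])
      rwa [norm_div, Complex.norm_real, Real.norm_of_nonneg hr0.le, div_le_iff₀ hr0,
        ← pow_succ] at h2
  obtain ⟨k, hk⟩ := hfreq.exists
  have hD : 0 < 2 * (R + 3) := by linarith
  have hnorm : ∀ z, ‖iter ω (k + L) z‖ < R + 3 → ‖z‖ < R + 3 := fun z hz =>
    norm_lt_of_norm_iter_lt hR (by linarith) hω hz
  have hxn := hnorm x ((hCK hx (k + L)).trans (by linarith))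
  have hlim : ∀ j, ‖(y - x) / (2 * (R + 3) : ℝ)‖ ≤ r ^ j := fun j => by
    refine key j k hk (fun z => (z - x) / (2 * (R + 3) : ℝ)) (by fun_prop) (fun z hz => ?_) (by simp)
    have hz' := hnorm z (connectedComponentIn_subset {z | ‖iter ω (k + L) z‖ < R + 3} x hz)
    rw [norm_div, Complex.norm_real, Real.norm_of_nonneg hD.le, div_le_one hD]
    linarith [norm_sub_le z x]
  have h0 := ge_of_tendsto' (tendsto_pow_atTop_nhds_zero_of_lt_one hr0.le hr1) hlim
  have h1 := norm_le_zero_iff.1 h0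
  rw [div_eq_zero_iff, or_iff_left (by exact_mod_cast hD.ne')] at h1
  exact (sub_eq_zero.1 h1).symm

/-! ### Normality on the escaping set. -/

/-- A sequence of indices either tends to infinity, so the maps converge uniformly to `∞`, or
repeats some index infinitely often, giving a constant subsequence. -/
theorem isNormalFamilyOn_of_le_norm {ω : ℕ → ℂ} {U : Set ℂ} {b : ℕ → ℝ} (hb : Tendsto b atTop atTop)
    (h : ∀ n, ∀ z ∈ U, b n ≤ ‖iter ω n z‖) : IsNormalFamilyOn (iter ω) U := by
  let : UniformSpace (OnePoint ℂ) := uniformSpaceOfCompactR1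
  intro s
  by_cases hs : Tendsto s atTop atTop
  · refine ⟨id, strictMono_id, fun _ => OnePoint.infty, ?_⟩
    apply TendstoUniformlyOn.tendstoLocallyUniformlyOn
    rw [tendstoUniformlyOn_iff_tendstoUniformlyOnFilter]
    have hT : Tendsto (fun p : ℕ × ℂ => (iter ω (s p.1) p.2 : OnePoint ℂ)) (atTop ×ˢ 𝓟 U)
        (𝓝 OnePoint.infty) := by
      refine OnePoint.tendsto_coe_infty.comp ?_
      rw [coclosedCompact_eq_cocompact, ← Metric.cobounded_eq_cocompact,
        ← tendsto_norm_atTop_iff_cobounded]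
      refine tendsto_atTop_mono' _ ?_ ((hb.comp hs).comp tendsto_fst)
      filter_upwards [tendsto_snd.eventually (mem_principal_self U)] with p hp
      exact h _ _ hp
    rw [tendstoUniformlyOnFilter_iff_tendsto]
    exact Uniform.tendsto_nhds_right.1 hT
  · obtain ⟨M, hM⟩ : ∃ M, ∃ᶠ j in atTop, s j < M := by
      rw [Filter.tendsto_atTop] at hs
      push Not at hs
      exact hs
    obtain ⟨m, -, hm⟩ : ∃ m ∈ Finset.range M, ∃ᶠ j in atTop, s j = m := by
      by_contra! hcon
      refine hM ?_
      have : ∀ᶠ j in atTop, ∀ m ∈ Finset.range M, s j ≠ m :=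
        (Filter.eventually_all_finset _).2 fun m hm => hcon m hm
      filter_upwards [this] with j hj hjM
      exact hj _ (Finset.mem_range.2 hjM) rfl
    obtain ⟨φ, hφ, hφm⟩ := extraction_of_frequently_atTop hm
    refine ⟨φ, hφ, fun z => (iter ω m z : OnePoint ℂ), ?_⟩
    intro u hu z _
    refine ⟨univ, univ_mem, Eventually.of_forall fun j w _ => ?_⟩
    simp only [hφm]
    exact refl_mem_uniformity hu

/-- Points of the Julia set never leave the escape disk. -/
theorem juliaSet_subset {R : ℝ} (hR : 0 ≤ R) {ω : ℕ → ℂ} (hω : ∀ n, ‖ω n‖ ≤ R) :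
    juliaSet ω ⊆ {z | ∀ n, ‖iter ω n z‖ < R + 2} := by
  intro z hz n
  by_contra! hn
  -- One more step makes the inequality strict, hence an open condition.
  have hn1 : R + 2 < ‖iter ω (n + 1) z‖ := by
    have := two_mul_norm_le hR (hω n) hn
    rw [iter]
    linarith
  refine hz {w | R + 2 < ‖iter ω (n + 1) w‖}
    (isOpen_lt continuous_const (differentiable_iter ω (n + 1)).continuous.norm) hn1 ?_
  refine isNormalFamilyOn_of_le_norm (b := fun k => if k < n + 1 then 0 else 2 ^ (k - (n + 1)))
    ?_ fun k w hw => ?_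
  · refine Tendsto.congr' (f₁ := fun k => 2 ^ (k - (n + 1))) ?_
      ((tendsto_pow_atTop_atTop_of_one_lt (by norm_num)).comp (tendsto_sub_atTop_nat (n + 1)))
    filter_upwards [eventually_ge_atTop (n + 1)] with k hk
    rw [if_neg (by omega)]
  · split_ifs with hk
    · exact norm_nonneg _
    · obtain ⟨m, rfl⟩ : ∃ m, k = n + 1 + m := ⟨k - (n + 1), by omega⟩
      have h1 : R + 2 < ‖iter ω (n + 1) w‖ := hw
      have := two_pow_mul_norm_le hR (fun i => hω (n + 1 + i)) h1.le m
      rw [← iter_add] at this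
      rw [Nat.add_sub_cancel_left]
      have h2 : (0 : ℝ) < 2 ^ m := by positivity
      nlinarith

/-! ### Exponential escape of the random critical orbit. -/

theorem iter_congr {ω ω' : ℕ → ℂ} {k : ℕ} (h : ∀ i < k, ω i = ω' i) (z : ℂ) :
    iter ω k z = iter ω' k z := by
  induction k with
  | zero => rfl
  | succ k ih => rw [iter, iter, ih fun i hi => h i (by omega), h k (by omega)]

theorem measurable_iter_param {α : Type*} [MeasurableSpace α] {u : α → ℕ → ℂ}
    (hu : ∀ i, Measurable fun a => u a i) (k : ℕ) (z : ℂ) : Measurable fun a => iter (u a) k z := by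
  induction k with
  | zero => exact measurable_const
  | succ k ih => exact (ih.pow_const 2).add (hu k)

/-- Uniformly in `u`, a random parameter pushes `u` outwards by at least `r < R` with positive
probability. -/
theorem exists_pos_le_measureReal_outward {r R : ℝ} (hr : 0 ≤ r) (hrR : r < R) :
    ∃ p : ℝ, 0 < p ∧ p ≤ 1 ∧
      ∀ u : ℂ, p ≤ (diskMeasure R).real {c : Disk R | ‖u‖ + r ≤ ‖u + (c : ℂ)‖} := by
  have hR : 0 < R := by linarith
  have := isProbabilityMeasure_diskMeasure hR
  set v : ℝ≥0∞ := ((volume : Measure ℂ) (Disk R))⁻¹ * volume (ball (0 : ℂ) ((R - r) / 2)) with hv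
  have key : ∀ u : ℂ, v ≤ diskMeasure R {c : Disk R | ‖u‖ + r ≤ ‖u + (c : ℂ)‖} := by
    intro u
    obtain ⟨e, he, hue⟩ : ∃ e : ℂ, ‖e‖ = 1 ∧ u = ‖u‖ * e := by
      rcases eq_or_ne u 0 with rfl | hu
      · exact ⟨1, by simp, by simp⟩
      · have : ‖u‖ ≠ 0 := norm_ne_zero_iff.2 hu
        refine ⟨u / ‖u‖, by simp [this], ?_⟩
        have : (‖u‖ : ℂ) ≠ 0 := by exact_mod_cast this
        field_simp
    rw [diskMeasure, Measure.smul_apply, smul_eq_mul,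
      (MeasurableEmbedding.subtype_coe isOpen_ball.measurableSet).comap_apply, hv]
    refine mul_le_mul' le_rfl ?_
    -- The ball centred at `(R + r)/2 · e` with radius `(R - r)/2` lies in the disk, and its points
    -- have component greater than `r` in the direction of `u`.
    refine (Measure.addHaar_ball_center volume (((R + r) / 2 : ℝ) * e) ((R - r) / 2)).symm.trans_le
      (measure_mono fun c hc => ?_)
    rw [mem_ball_iff_norm] at hc
    have hcen : ∀ t : ℝ, 0 ≤ t → ‖(t : ℂ) * e‖ = t := fun t ht => by
      rw [norm_mul, he, mul_one, Complex.norm_real, Real.norm_of_nonneg ht]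
    have hcR : c ∈ Disk R := by
      rw [mem_ball_zero_iff]
      have h1 := norm_le_insert' c (((R + r) / 2 : ℝ) * e)
      rw [hcen _ (by linarith)] at h1
      linarith
    refine ⟨⟨c, hcR⟩, ?_, rfl⟩
    rw [mem_ofPred_eq]
    have h2 : ((‖u‖ + (R + r) / 2 : ℝ) : ℂ) * e = (u + c) - (c - ((R + r) / 2 : ℝ) * e) := by
      nth_rw 2 [hue]
      push_cast
      ring
    have h3 := norm_sub_le (u + c) (c - ((R + r) / 2 : ℝ) * e)
    rw [← h2, hcen _ (by linarith [norm_nonneg u])] at h3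
    linarith
  have hv1 : v ≤ 1 := (key 0).trans prob_le_one
  have hvtop : v ≠ ∞ := (hv1.trans_lt ENNReal.one_lt_top).ne
  have hv0 : v ≠ 0 := mul_ne_zero (ENNReal.inv_ne_zero.2 measure_ball_lt_top.ne)
    (measure_ball_pos volume _ (by linarith)).ne'
  exact ⟨v.toReal, ENNReal.toReal_pos hv0 hvtop, ENNReal.toReal_le_of_le_ofReal one_pos.le (by simpa),
    fun u => ENNReal.toReal_mono (measure_ne_top _ _) (key u)⟩

/-- A Lyapunov profile for a process on `[0, ∞)` that gains `κ` with probability `p` and is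
absorbed beyond `B`. -/
theorem exists_lyapunov_profile {p κ : ℝ} (B : ℝ) (hp : 0 < p) (hp1 : p ≤ 1) (hκ : 0 < κ) :
    ∃ (Φ : ℝ → ℝ) (ρ : ℝ), ρ < 1 ∧ 0 ≤ ρ ∧ Antitone Φ ∧ (∀ t, 0 ≤ Φ t) ∧ (∀ t, Φ t ≤ 1) ∧
      (∀ t < B, 1 / 2 ≤ Φ t) ∧ (∀ t, B ≤ t → Φ t = 0) ∧
      ∀ t, 0 ≤ t → t < B → p * Φ (t + κ) + (1 - p) * Φ 0 ≤ ρ * Φ t := by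
  -- Chosen so that a gain `κ` multiplies `S` by `2 / p`: the expected reward `p * S (t + κ)` is
  -- then `2 * S t`, even if failure resets the process to `0`.
  set b := Real.log (2 / p) / κ with hb
  have h2p : 1 < 2 / p := by rw [lt_div_iff₀ hp]; linarith
  have hb0 : 0 < b := div_pos (Real.log_pos h2p) hκ
  set S : ℝ → ℝ := fun t => p / 2 * Real.exp (b * (t - B)) with hS
  have hSpos : ∀ t, 0 < S t := fun t => by positivity
  have hSmono : Monotone S := fun s t hst => by
    simp only [hS]
    gcongr
  have hSB : ∀ t, t ≤ B → S t ≤ p / 2 := fun t ht => by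
    have := hSmono ht
    simpa [hS] using this
  have hSκ : ∀ t, p * S (t + κ) = 2 * S t := fun t => by
    have h1 : b * (t + κ - B) = b * (t - B) + Real.log (2 / p) := by
      rw [hb]; field_simp; ring
    simp only [hS, h1, Real.exp_add, Real.exp_log (one_pos.trans h2p)]
    field_simp
  set Φ : ℝ → ℝ := fun t => if t < B then 1 - S t else 0 with hΦ
  have hΦlt : ∀ t < B, Φ t = 1 - S t := fun t ht => if_pos ht
  have hΦge : ∀ t, B ≤ t → Φ t = 0 := fun t ht => if_neg (not_lt.2 ht)
  have hΦ0 : ∀ t, 0 ≤ Φ t := fun t => by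
    rcases lt_or_ge t B with h | h
    · rw [hΦlt t h]; linarith [hSB t h.le]
    · rw [hΦge t h]
  have hΦ1 : ∀ t, Φ t ≤ 1 := fun t => by
    rcases lt_or_ge t B with h | h
    · rw [hΦlt t h]; linarith [hSpos t]
    · rw [hΦge t h]; exact zero_le_one
  refine ⟨Φ, 1 - min (S 0) (p / 2), by linarith [lt_min (hSpos 0) (half_pos hp)],
    by linarith [min_le_right (S 0) (p / 2)], ?_, hΦ0, hΦ1, ?_, hΦge, ?_⟩
  · intro s t hst
    rcases lt_or_ge t B with h | h
    · rw [hΦlt t h, hΦlt s (hst.trans_lt h)]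
      linarith [hSmono hst]
    · rw [hΦge t h]; exact hΦ0 s
  · intro t ht
    rw [hΦlt t ht]; linarith [hSB t ht.le]
  · intro t ht htB
    have hs0 : S 0 ≤ S t := hSmono ht
    have hm1 := min_le_left (S 0) (p / 2)
    have hm2 := min_le_right (S 0) (p / 2)
    have hm0 : 0 < min (S 0) (p / 2) := lt_min (hSpos 0) (half_pos hp)
    set m := min (S 0) (p / 2)
    have hst := hSB t htB.le
    have hst0 := hSpos t
    have hΦ00 := hΦ1 0
    rw [hΦlt t htB]
    have h1 : (1 - p) * Φ 0 ≤ 1 - p := by nlinarith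
    rcases lt_or_ge (t + κ) B with h | h
    · rw [hΦlt _ h, mul_sub, hSκ]
      nlinarith
    · rw [hΦge _ h]
      nlinarith

/-- The critical point fails to escape within `k` steps with exponentially small probability. -/
theorem exists_measure_norm_iter_lt_le {R : ℝ} (hR : 1 / 4 < R) :
    ∃ q : ℝ≥0∞, q < 1 ∧ ∀ n k : ℕ, sequenceMeasure R
      {ω | ‖iter (fun i => (ω (n + i) : ℂ)) k 0‖ < 2 * (R + 2)} ≤ 2 * q ^ k := by
  have hR0 : 0 < R := by linarith
  have hμ := isProbabilityMeasure_diskMeasure hR0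
  have hP : IsProbabilityMeasure (sequenceMeasure R) := by
    unfold sequenceMeasure; infer_instance
  obtain ⟨p, hp, hp1, hout⟩ := exists_pos_le_measureReal_outward (r := (R + 1 / 4) / 2) (R := R)
    (by linarith) (by linarith)
  obtain ⟨Φ, ρ, hρ1, hρ0, hanti, hΦ0, hΦ1, hΦhalf, hΦB, hdrift⟩ :=
    exists_lyapunov_profile (κ := (R - 1 / 4) / 2) (2 * (R + 2)) hp hp1 (by linarith)
  have hΦm : Measurable Φ := hanti.measurable
  set F : ℂ → ℝ≥0∞ := fun z => ENNReal.ofReal (Φ ‖z‖) with hF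
  have hFm : Measurable F := (hΦm.comp measurable_norm).ennreal_ofReal
  have hstep : ∀ z : ℂ, ∫⁻ c : Disk R, F (z ^ 2 + c) ∂diskMeasure R ≤ ENNReal.ofReal ρ * F z := by
    intro z
    have hm : Measurable fun c : Disk R => Φ ‖z ^ 2 + (c : ℂ)‖ := hΦm.comp (by fun_prop)
    have hint : Integrable (fun c : Disk R => Φ ‖z ^ 2 + (c : ℂ)‖) (diskMeasure R) :=
      Integrable.of_bound hm.aestronglyMeasurable 1 (Eventually.of_forall fun c => by
        rw [Real.norm_of_nonneg (hΦ0 _)]; exact hΦ1 _)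
    rw [← ofReal_integral_eq_lintegral_ofReal hint (Eventually.of_forall fun c => hΦ0 _),
      ← ENNReal.ofReal_mul hρ0]
    refine ENNReal.ofReal_le_ofReal ?_
    rcases lt_or_ge ‖z‖ (2 * (R + 2)) with hz | hz
    · set G := {c : Disk R | ‖z ^ 2‖ + (R + 1 / 4) / 2 ≤ ‖z ^ 2 + (c : ℂ)‖} with hG
      have hGm : MeasurableSet G := measurableSet_le measurable_const (by fun_prop)
      have hint2 : Integrable (fun c => Φ 0 + G.indicator
          (fun _ => Φ (‖z‖ + (R - 1 / 4) / 2) - Φ 0) c) (diskMeasure R) :=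
        (integrable_const _).add ((integrable_const _).indicator hGm)
      have hle : ∫ c : Disk R, Φ ‖z ^ 2 + (c : ℂ)‖ ∂diskMeasure R ≤
          Φ 0 + (diskMeasure R).real G * (Φ (‖z‖ + (R - 1 / 4) / 2) - Φ 0) := by
        refine (integral_mono hint hint2 fun c => ?_).trans_eq ?_
        · by_cases hc : c ∈ G
          · simp only [Set.indicator_of_mem hc, add_sub_cancel]
            refine hanti ?_
            have : ‖z ^ 2‖ + (R + 1 / 4) / 2 ≤ ‖z ^ 2 + (c : ℂ)‖ := hc
            rw [norm_pow] at this
            -- Here `1/4` enters: `‖z‖² ≥ ‖z‖ - 1/4` turns the push `(R + 1/4)/2` into a net gain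
            -- `(R - 1/4)/2`.
            nlinarith [sq_nonneg (‖z‖ - 1 / 2)]
          · simp only [Set.indicator_of_notMem hc, add_zero]
            exact hanti (norm_nonneg _)
        · rw [integral_add (integrable_const _) ((integrable_const _).indicator hGm),
            integral_indicator_const _ hGm]
          simp
      have h1 : Φ (‖z‖ + (R - 1 / 4) / 2) ≤ Φ 0 := hanti (by linarith [norm_nonneg z])
      have h2 := hout (z ^ 2)
      have h3 := hdrift ‖z‖ (norm_nonneg z) hz
      nlinarith
    · rw [hΦB _ hz, mul_zero]
      refine le_of_eq (integral_eq_zero_of_ae (Eventually.of_forall fun c => ?_))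
      refine hΦB _ (hz.trans ?_)
      have := two_mul_norm_le hR0.le (mem_ball_zero_iff.1 c.2).le (z := z) (by linarith)
      linarith [norm_nonneg z]
  have hXm : ∀ n k, Measurable fun ω : ℕ → Disk R => iter (fun i => (ω (n + i) : ℂ)) k 0 :=
    fun n k => measurable_iter_param (fun i => by fun_prop) k 0
  have hindep : ∀ n k, IndepFun (fun ω : ℕ → Disk R => iter (fun i => (ω (n + i) : ℂ)) k 0)
      (fun ω => ω (n + k)) (sequenceMeasure R) := by
    intro n k
    have h1 : iIndepFun (fun i (ω : ℕ → Disk R) => ω i) (sequenceMeasure R) :=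
      iIndepFun_infinitePi (X := fun _ ω => ω) fun _ => measurable_id
    have h2 := h1.indepFun_finset (Finset.range (n + k)) {n + k} (by simp) (by fun_prop)
    -- The first `k` steps use only parameters with index below `n + k`; the default `0` elsewhere
    -- is never read.
    let u : (Finset.range (n + k) → Disk R) → ℕ → ℂ := fun a i =>
      if h : n + i ∈ Finset.range (n + k) then a ⟨n + i, h⟩ else 0
    have hu : ∀ i, Measurable fun a => u a i := fun i => by
      by_cases h : n + i ∈ Finset.range (n + k)
      · simp only [u, dif_pos h]; fun_prop
      · simp only [u, dif_neg h]; fun_prop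
    have hψ : Measurable fun a : ({n + k} : Finset ℕ) → Disk R =>
        a ⟨n + k, Finset.mem_singleton_self _⟩ := measurable_pi_apply _
    have h3 := h2.comp (measurable_iter_param hu k 0) hψ
    convert h3 using 1
    · funext ω
      refine iter_congr (fun i hi => ?_) 0
      simp only [u, dif_pos (Finset.mem_range.2 (Nat.add_lt_add_left hi n))]
    · rfl
  have hdecay : ∀ n k, ∫⁻ ω : ℕ → Disk R, F (iter (fun i => (ω (n + i) : ℂ)) k 0)
      ∂sequenceMeasure R ≤ ENNReal.ofReal ρ ^ k := by
    intro n k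
    induction k with
    | zero =>
      rw [pow_zero]
      refine (lintegral_mono (g := fun _ => 1) fun ω => ?_).trans (by simp)
      exact ENNReal.ofReal_le_one.2 (hΦ1 _)
    | succ k ih =>
      have hlaw := (hindep n k).map_prod_eq_prod_map_map (hXm n k).aemeasurable
        (measurable_pi_apply _).aemeasurable
      have heval : (sequenceMeasure R).map (fun ω => ω (n + k)) = diskMeasure R :=
        Measure.infinitePi_map_eval _ _
      rw [heval] at hlaw
      have hmeas : Measurable fun q : ℂ × Disk R => F (q.1 ^ 2 + q.2) := hFm.comp (by fun_prop)
      calc ∫⁻ ω : ℕ → Disk R, F (iter (fun i => (ω (n + i) : ℂ)) (k + 1) 0) ∂sequenceMeasure R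
          = ∫⁻ q, F (q.1 ^ 2 + q.2) ∂(sequenceMeasure R).map fun ω : ℕ → Disk R =>
              (iter (fun i => (ω (n + i) : ℂ)) k 0, ω (n + k)) := by
            rw [lintegral_map hmeas ((hXm n k).prodMk (measurable_pi_apply _))]
            rfl
        _ = ∫⁻ x, ∫⁻ c : Disk R, F (x ^ 2 + c) ∂diskMeasure R ∂(sequenceMeasure R).map
              fun ω : ℕ → Disk R => iter (fun i => (ω (n + i) : ℂ)) k 0 := by
            rw [hlaw, lintegral_prod _ hmeas.aemeasurable]
        _ ≤ ∫⁻ x, ENNReal.ofReal ρ * F x ∂(sequenceMeasure R).map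
              fun ω : ℕ → Disk R => iter (fun i => (ω (n + i) : ℂ)) k 0 := lintegral_mono hstep
        _ ≤ ENNReal.ofReal ρ ^ (k + 1) := by
            rw [lintegral_const_mul _ hFm, lintegral_map hFm (hXm n k), pow_succ']
            gcongr
  refine ⟨ENNReal.ofReal ρ, ENNReal.ofReal_lt_one.2 hρ1, fun n k => ?_⟩
  -- Markov's inequality: `F` is at least `1/2` as long as the orbit has not escaped.
  have hmarkov := mul_meas_ge_le_lintegral (μ := sequenceMeasure R) (hFm.comp (hXm n k)) (1 / 2)
  have hsub : {ω : ℕ → Disk R | ‖iter (fun i => (ω (n + i) : ℂ)) k 0‖ < 2 * (R + 2)} ⊆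
      {ω | 1 / 2 ≤ (F ∘ fun ω : ℕ → Disk R => iter (fun i => (ω (n + i) : ℂ)) k 0) ω} := fun ω hω => by
    have h1 := ENNReal.ofReal_le_ofReal (hΦhalf _ hω)
    rwa [ENNReal.ofReal_div_of_pos two_pos, ENNReal.ofReal_one, ENNReal.ofReal_ofNat] at h1
  have h2 := (mul_le_mul_right (measure_mono (μ := sequenceMeasure R) hsub) (1 / 2)).trans
    (hmarkov.trans (hdecay n k))
  rw [one_div] at h2
  calc sequenceMeasure R {ω | ‖iter (fun i => (ω (n + i) : ℂ)) k 0‖ < 2 * (R + 2)}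
      = 2 * (2⁻¹ * sequenceMeasure R {ω | ‖iter (fun i => (ω (n + i) : ℂ)) k 0‖ < 2 * (R + 2)}) := by
        rw [← mul_assoc, ENNReal.mul_inv_cancel two_ne_zero ENNReal.ofNat_ne_top, one_mul]
    _ ≤ 2 * ENNReal.ofReal ρ ^ k := by gcongr

/-! ### Almost sure conclusion. -/

/-- If the measures of all `s m` are at most `ε`, so is the measure of the set of points that lie in
`s m` for all large `m`. -/
theorem measure_eventually_le {α : Type*} [MeasurableSpace α] {μ : Measure α} {s : ℕ → Set α}
    {ε : ℝ≥0∞} (h : ∀ m, μ (s m) ≤ ε) : μ {a | ∀ᶠ m in atTop, a ∈ s m} ≤ ε := by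
  have heq : {a | ∀ᶠ m in atTop, a ∈ s m} = ⋃ M : ℕ, {a | ∀ m ≥ M, a ∈ s m} := by
    ext a
    simp [eventually_atTop]
  have hmono : Monotone fun M : ℕ => {a | ∀ m ≥ M, a ∈ s m} :=
    fun M M' hM a ha m hm => ha m (hM.trans hm)
  rw [heq, hmono.measure_iUnion]
  exact iSup_le fun M => (measure_mono fun a (ha : ∀ m ≥ M, a ∈ s m) => ha M le_rfl).trans (h M)

/-- For each fixed `L`, a sequence with non-totally-disconnected Julia set is bad at all large times
`m`, an event of probability at most `C q^L`. Letting `L` grow removes the need for independence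
between different `m`. -/
theorem measure_not_isTotallyDisconnected_eq_zero {R : ℝ} (hR : 1 / 4 < R) :
    sequenceMeasure R {ω : ℕ → Disk R |
      ¬ IsTotallyDisconnected (juliaSet fun n => (ω n : ℂ))} = 0 := by
  obtain ⟨q, hq, hdecay⟩ := exists_measure_norm_iter_lt_le hR
  set bad : ℕ → ℕ → Set (ℕ → Disk R) := fun L m =>
    {ω | ∃ n < m, ‖iter (fun i => (ω (n + i) : ℂ)) (m + L - n) 0‖ < 2 * (R + 2)} with hbad
  have hbadle : ∀ L m, sequenceMeasure R (bad L m) ≤ 2 * (1 - q)⁻¹ * q ^ L := by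
    intro L m
    have hsub : bad L m ⊆ ⋃ n ∈ Finset.range m,
        {ω : ℕ → Disk R | ‖iter (fun i => (ω (n + i) : ℂ)) (m + L - n) 0‖ < 2 * (R + 2)} := by
      rintro ω ⟨n, hn, h⟩
      exact mem_iUnion₂.2 ⟨n, Finset.mem_range.2 hn, h⟩
    calc sequenceMeasure R (bad L m)
        ≤ ∑ n ∈ Finset.range m, 2 * q ^ (m + L - n) :=
          (measure_mono hsub).trans ((measure_biUnion_finset_le _ _).trans
            (Finset.sum_le_sum fun n _ => hdecay n _))
      _ ≤ ∑ n ∈ Finset.range m, 2 * q ^ L * q ^ (m - 1 - n) := by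
          -- The exponent `m + L - n` exceeds `L + (m - 1 - n)` by one; the spare factor `q` is
          -- dropped so that the sum reflects to a geometric one.
          refine Finset.sum_le_sum fun n hn => ?_
          have hnm := Finset.mem_range.1 hn
          rw [mul_assoc, ← pow_add]
          gcongr 2 * ?_
          exact pow_le_pow_of_le_one zero_le hq.le (by omega)
      _ = 2 * q ^ L * ∑ n ∈ Finset.range m, q ^ n := by
          rw [← Finset.mul_sum, Finset.sum_range_reflect]
      _ ≤ 2 * q ^ L * (1 - q)⁻¹ := by
          gcongr
          rw [← ENNReal.tsum_geometric]
          exact ENNReal.sum_le_tsum _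
      _ = 2 * (1 - q)⁻¹ * q ^ L := by ring
  have hle : ∀ L, sequenceMeasure R {ω : ℕ → Disk R |
      ¬ IsTotallyDisconnected (juliaSet fun n => (ω n : ℂ))} ≤ 2 * (1 - q)⁻¹ * q ^ L := by
    intro L
    refine (measure_mono fun ω hω => ?_).trans (measure_eventually_le (hbadle L))
    by_contra hev
    have hωR : ∀ n, ‖(ω n : ℂ)‖ ≤ R := fun n => (mem_ball_zero_iff.1 (ω n).2).le
    refine hω fun t ht => isTotallyDisconnected_of_frequently (by linarith) hωR L ?_ t
      (ht.trans (juliaSet_subset (by linarith) hωR))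
    refine (not_eventually.1 hev).mono fun m hm n hn => ?_
    by_contra! h
    exact hm ⟨n, hn, h⟩
  have hfin : 2 * (1 - q)⁻¹ ≠ ∞ := ENNReal.mul_ne_top ENNReal.ofNat_ne_top
    (ENNReal.inv_ne_top.2 (tsub_pos_of_lt hq).ne')
  have hlim := ENNReal.Tendsto.const_mul (ENNReal.tendsto_pow_atTop_nhds_zero_of_lt_one hq)
    (Or.inr hfin)
  rw [mul_zero] at hlim
  exact le_antisymm (ge_of_tendsto' hlim hle) zero_le

end RandomJulia

theorem theoremA (R : ℝ) (hR : 1 / 4 < R) :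
    NullMeasurableSet
        {ω : ℕ → RandomJulia.Disk R |
          IsTotallyDisconnected (RandomJulia.juliaSet fun n => (ω n : ℂ))}
        (RandomJulia.sequenceMeasure R) ∧
      RandomJulia.sequenceMeasure R
        {ω : ℕ → RandomJulia.Disk R |
          IsTotallyDisconnected (RandomJulia.juliaSet fun n => (ω n : ℂ))} = 1 := by
  have hμ := RandomJulia.isProbabilityMeasure_diskMeasure (R := R) (by linarith)
  have hP : IsProbabilityMeasure (RandomJulia.sequenceMeasure R) := by
    unfold RandomJulia.sequenceMeasure; infer_instance
  have hae : {ω : ℕ → RandomJulia.Disk R |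
      IsTotallyDisconnected (RandomJulia.juliaSet fun n => (ω n : ℂ))}
        =ᵐ[RandomJulia.sequenceMeasure R] Set.univ :=
    ae_eq_univ.2 (RandomJulia.measure_not_isTotallyDisconnected_eq_zero hR)
  exact ⟨MeasurableSet.univ.nullMeasurableSet.congr hae.symm,
    (measure_congr hae).trans measure_univ⟩
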